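/- Let $A=(a_{ij})_{1\le i,j\le n}$ be a real square matrix of any size $n$. Call $A$ a Hankel matrix if $a_{ij}=a_{i'j'}$ whenever $i+j=i'+j'$. For a positive integer $r$, call $A$ totally nonnegative of order $r$ ($\mathrm{TN}_r$) if every minor of $A$ of size $\le r$ is nonnegative, and totally positive of order $r$ ($\mathrm{TP}_r$) if every minor of $A$ of size $\le r$ is positive; here a minor is the determinant of a square submatrix whose rows and columns are kept in their original order. For a matrix $A$ with nonnegative entries and real $t>0$, let $A^{\circ t}=(a_{ij}^{\,t})_{1\le i,j\le n}$ be its entrywise power. Then for every integer $r\ge 3$: if $A$ is a $\mathrm{TN}_r$ (resp. $\mathrm{TP}_r$) Hankel matrix, then $A^{\circ t}$ is also a $\mathrm{TN}_r$ (resp. $\mathrm{TP}_r$) Hankel matrix for all real $t\ge r-2$. -/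

import Mathlib

/-- A matrix is Hankel if its `(i, j)` entry depends only on `i + j`. -/
def IsHankel {m n : ℕ} (A : Matrix (Fin m) (Fin n) ℝ) : Prop :=
  ∀ (i i' : Fin m) (j j' : Fin n), (i : ℕ) + (j : ℕ) = (i' : ℕ) + (j' : ℕ) → A i j = A i' j'

/-- Totally nonnegative of order `r`: every minor of size at most `r` is nonnegative. The rows and
columns of the submatrix are kept in their original order. -/
def IsTNOrder {m n : ℕ} (r : ℕ) (A : Matrix (Fin m) (Fin n) ℝ) : Prop :=
  ∀ k : ℕ, k ≤ r → ∀ (f : Fin k → Fin m) (g : Fin k → Fin n), StrictMono f → StrictMono g →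
    0 ≤ (A.submatrix f g).det

/-- Totally positive of order `r`: every minor of size at most `r` is positive. -/
def IsTPOrder {m n : ℕ} (r : ℕ) (A : Matrix (Fin m) (Fin n) ℝ) : Prop :=
  ∀ k : ℕ, k ≤ r → ∀ (f : Fin k → Fin m) (g : Fin k → Fin n), StrictMono f → StrictMono g →
    0 < (A.submatrix f g).det

/-- The Hadamard (entrywise) real power of a matrix with nonnegative entries. -/
noncomputable def hadamardRPow {m n : ℕ} (A : Matrix (Fin m) (Fin n) ℝ) (t : ℝ) :
    Matrix (Fin m) (Fin n) ℝ :=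
  A.map (fun x : ℝ => x ^ t)

/-!
A block of a Hankel matrix with consecutive rows and columns is itself a symmetric Hankel matrix,
and each of its principal minors is a minor of the whole matrix. Since a symmetric matrix is positive
(semi)definite once its principal minors are positive (nonnegative), the blocks of size at most `r`
of a `TP_r` (`TN_r`) Hankel matrix are positive definite (semidefinite):
`IsTPOrder.posDef_hankelBlock`, `IsTNOrder.posSemidef_hankelBlock`. Conversely, by Fekete's criterion
(`det_pos_of_consecutive`), a Hankel matrix whose blocks of size at most `r` are positive definite is
`TP_r`; this is `isTPOrder_of_posDef_hankelBlock`.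

The strict case thus reduces to the FitzGerald–Horn theorem (`posDef_map_rpow`): for a positive
definite `k × k` matrix with positive entries, the entrywise `t`-th power is positive definite for
`t ≥ k - 2`, `t > 0`. It is proved by induction on `k`, peeling off a rank one matrix.

In the nonnegative case, adding a small positive multiple of a Hankel matrix of moments with
positive definite blocks makes the matrix `TP_r` (`IsTNOrder.isTPOrder_add_moments`). The strict case
applies to this perturbation, and the minors of its entrywise power are continuous in the
perturbation parameter.
-/

open Matrix

/-! ### Fekete's criterion for total positivity -/

/-- Dividing each row by its first entry and subtracting from it the preceding row reduces a
determinant to one of size one less. -/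
lemma det_eq_prod_mul_det_sub {k : ℕ} (b : Fin (k + 1) → ℕ → ℝ) (hb : ∀ i, b i 0 ≠ 0) :
    det (of fun i j : Fin (k + 1) => b i j) = (∏ i, b i 0) *
      det (of fun i j : Fin k => b i.succ (j + 1) / b i.succ 0
        - b i.castSucc (j + 1) / b i.castSucc 0) := by
  have h1 : (of fun i j : Fin (k + 1) => b i j)
      = of fun i j : Fin (k + 1) => b i 0 * (of fun i j : Fin (k + 1) => b i j / b i 0) i j := by
    ext i j
    simp only [of_apply]
    rw [mul_div_cancel₀ _ (hb i)]
  rw [h1, det_mul_column]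
  congr 1
  let B : Matrix (Fin (k + 1)) (Fin (k + 1)) ℝ := of fun i j =>
    Fin.cases (b 0 j / b 0 0)
      (fun l => b l.succ j / b l.succ 0 - b l.castSucc j / b l.castSucc 0) i
  have hB : det (of fun i j : Fin (k + 1) => b i j / b i 0) = det B :=
    det_eq_of_forall_row_eq_smul_add_pred (fun _ => 1) (fun j => rfl) fun i j => by simp [B]
  rw [hB, det_succ_column_zero, Fin.sum_univ_succ]
  have h0 : B 0 0 = 1 := by simp [B, hb 0]
  have hs : ∀ i : Fin k, B i.succ 0 = 0 := fun i => by simp [B, hb i.succ, hb i.castSucc]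
  simp only [h0, hs, mul_zero, zero_mul, Finset.sum_const_zero, add_zero, Fin.val_zero, pow_zero,
    one_mul]
  rfl

/-- Fekete's criterion for a matrix with `k` columns and `N` rows: if all minors with consecutive
rows and an initial segment of the columns are positive, then so are all maximal minors. Consecutive
differences of the normalized rows inherit the hypothesis, and a maximal minor expands, by
multilinearity, as a positive combination of maximal minors of the matrix of these differences. -/
theorem det_pos_of_consecutive_rows (k : ℕ) : ∀ (N : ℕ) (a : ℕ → ℕ → ℝ),
    (∀ m p : ℕ, m ≤ k → p + m ≤ N → 0 < det (of fun i j : Fin m => a (p + i) j)) →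
    ∀ f : Fin k → ℕ, StrictMono f → (∀ i, f i < N) →
      0 < det (of fun i j : Fin k => a (f i) j) := by
  induction k with
  | zero => intros; simp
  | succ k ih =>
    intro N a h f hf hfN
    have hpos : ∀ i < N, 0 < a i 0 := fun i hi => by
      simpa using h 1 i (by omega) (by omega)
    let e : ℕ → ℕ → ℝ := fun i j => a (i + 1) (j + 1) / a (i + 1) 0 - a i (j + 1) / a i 0
    have he : ∀ g : Fin k → ℕ, StrictMono g → (∀ i, g i < N - 1) →
        0 < det (of fun i j : Fin k => e (g i) j) := by
      refine ih (N - 1) e fun m p hm hp => ?_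
      rcases Nat.eq_zero_or_pos m with rfl | hm0
      · simp
      have h1 := h (m + 1) p (by omega) (by omega)
      have hp' : ∀ i : Fin (m + 1), 0 < a (p + i) 0 := fun i => hpos _ (by omega)
      rw [det_eq_prod_mul_det_sub (fun i => a (p + i)) fun i => (hp' i).ne'] at h1
      exact pos_of_mul_pos_right h1 (Finset.prod_nonneg fun i _ => (hp' i).le)
    rw [det_eq_prod_mul_det_sub (fun i => a (f i)) fun i => (hpos _ (hfN i)).ne']
    refine mul_pos (Finset.prod_pos fun i _ => hpos _ (hfN i)) ?_
    have hlt : ∀ i : Fin k, f i.castSucc < f i.succ := fun i => hf Fin.castSucc_lt_succ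
    have hsum : (of fun i j : Fin k => a (f i.succ) (j + 1) / a (f i.succ) 0
        - a (f i.castSucc) (j + 1) / a (f i.castSucc) 0)
        = fun i => ∑ l ∈ Finset.Ico (f i.castSucc) (f i.succ), fun j : Fin k => e l j := by
      ext i j
      simp only [of_apply, Finset.sum_apply, e]
      rw [Finset.sum_Ico_sub (fun l => a l (j + 1) / a l 0) (hlt i).le]
    rw [hsum]
    have hexp := (detRowAlternating (n := Fin k) (R := ℝ)).toMultilinearMap.map_sum_finset
      (fun (_ : Fin k) (l : ℕ) => fun j : Fin k => e l j)
      (fun i : Fin k => Finset.Ico (f i.castSucc) (f i.succ))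
    refine lt_of_lt_of_eq ?_ hexp.symm
    refine Finset.sum_pos (fun g hg => he g ?_ ?_) ?_
    · intro i i' hii
      have h1 := Finset.mem_Ico.1 (Fintype.mem_piFinset.1 hg i)
      have h2 := Finset.mem_Ico.1 (Fintype.mem_piFinset.1 hg i')
      have h3 : f i.succ ≤ f i'.castSucc := hf.monotone (by
        rw [Fin.le_def]; simpa using hii)
      omega
    · intro i
      have h1 := Finset.mem_Ico.1 (Fintype.mem_piFinset.1 hg i)
      have h2 := hfN i.succ
      omega
    · exact Fintype.piFinset_nonempty.2 fun i => Finset.nonempty_Ico.2 (hlt i)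

/-- Fekete's criterion: an `n × n` array all of whose minors of size at most `r` with consecutive
rows and consecutive columns are positive has all its minors of size at most `r` positive. -/
theorem det_pos_of_consecutive {r n : ℕ} (a : ℕ → ℕ → ℝ)
    (h : ∀ m p q : ℕ, m ≤ r → p + m ≤ n → q + m ≤ n →
      0 < det (of fun i j : Fin m => a (p + i) (q + j)))
    {k : ℕ} (hk : k ≤ r) (f g : Fin k → ℕ) (hf : StrictMono f) (hg : StrictMono g)
    (hfn : ∀ i, f i < n) (hgn : ∀ i, g i < n) :
    0 < det (of fun i j : Fin k => a (f i) (g j)) := by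
  have h1 : ∀ m q : ℕ, m ≤ r → q + m ≤ n → ∀ f : Fin m → ℕ, StrictMono f → (∀ i, f i < n) →
      0 < det (of fun i j : Fin m => a (f i) (q + j)) := fun m q hm hq =>
    det_pos_of_consecutive_rows m n (fun i j => a i (q + j)) fun m' p hm' hp =>
      h m' p q (by omega) hp (by omega)
  rw [← det_transpose]
  -- The array is extended by zero beyond the `k` chosen rows.
  have h2 := det_pos_of_consecutive_rows k n
    (fun i j => if hj : j < k then a (f ⟨j, hj⟩) i else 0) (fun m q hm hq => by
      rw [← det_transpose]
      have := h1 m q (by omega) hq (fun i => f (Fin.castLE hm i))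
        (hf.comp (Fin.strictMono_castLE hm)) fun i => hfn _
      convert this using 2
      ext i j
      simp [show (i : ℕ) < k by omega, Fin.castLE]) g hg hgn
  convert h2 using 2
  ext i j
  simp

/-! ### Positive (semi)definiteness from principal minors -/

/-- A symmetric real matrix is positive semidefinite iff the associated quadratic form, written as
a double sum, is nonnegative. -/
lemma posSemidef_iff_sum {k : ℕ} {A : Matrix (Fin k) (Fin k) ℝ} (hA : ∀ i j, A i j = A j i) :
    A.PosSemidef ↔ ∀ x : Fin k → ℝ, 0 ≤ ∑ i, ∑ j, x i * A i j * x j := by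
  have hH : A.IsHermitian := by ext i j; simpa using hA j i
  rw [posSemidef_iff_dotProduct_mulVec, and_iff_right hH]
  simp [dotProduct, mulVec, Finset.mul_sum, mul_assoc]

/-- A symmetric real matrix is positive definite iff the associated quadratic form, written as
a double sum, is positive away from zero. -/
lemma posDef_iff_sum {k : ℕ} {A : Matrix (Fin k) (Fin k) ℝ} (hA : ∀ i j, A i j = A j i) :
    A.PosDef ↔ ∀ x : Fin k → ℝ, x ≠ 0 → 0 < ∑ i, ∑ j, x i * A i j * x j := by
  have hH : A.IsHermitian := by ext i j; simpa using hA j i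
  rw [posDef_iff_dotProduct_mulVec, and_iff_right hH]
  simp [dotProduct, mulVec, Finset.mul_sum, mul_assoc]

lemma Matrix.PosDef.apply_comm {k : ℕ} {A : Matrix (Fin k) (Fin k) ℝ} (hA : A.PosDef)
    (i j : Fin k) : A i j = A j i := by
  simpa using hA.isHermitian.apply j i

/-- The Schur complement of the `(0, 0)` entry of a real matrix. If that entry is zero, then this is
just the submatrix obtained by deleting the first row and column. -/
noncomputable def schurCompl {k : ℕ} (A : Matrix (Fin (k + 1)) (Fin (k + 1)) ℝ) :
    Matrix (Fin k) (Fin k) ℝ :=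
  of fun i j => A i.succ j.succ - A i.succ 0 * A 0 j.succ / A 0 0

lemma schurCompl_apply {k : ℕ} (A : Matrix (Fin (k + 1)) (Fin (k + 1)) ℝ) (i j : Fin k) :
    schurCompl A i j = A i.succ j.succ - A i.succ 0 * A 0 j.succ / A 0 0 := rfl

lemma schurCompl_comm {k : ℕ} {A : Matrix (Fin (k + 1)) (Fin (k + 1)) ℝ}
    (hA : ∀ i j, A i j = A j i) (i j : Fin k) : schurCompl A i j = schurCompl A j i := by
  rw [schurCompl_apply, schurCompl_apply, hA i.succ j.succ, hA i.succ 0, hA 0 j.succ, mul_comm]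

lemma det_eq_mul_det_schurCompl {k : ℕ} (A : Matrix (Fin (k + 1)) (Fin (k + 1)) ℝ)
    (h0 : A 0 0 ≠ 0) : A.det = A 0 0 * (schurCompl A).det := by
  let B : Matrix (Fin (k + 1)) (Fin (k + 1)) ℝ := of fun i j =>
    Fin.cases (A 0 j) (fun l => A l.succ j - A l.succ 0 / A 0 0 * A 0 j) i
  have hB : A.det = B.det := det_eq_of_forall_row_eq_smul_add_const
    (fun i => Fin.cases 0 (fun l => A l.succ 0 / A 0 0) i) 0 rfl fun i j => by
      refine Fin.cases ?_ (fun l => ?_) i <;> simp [B]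
  rw [hB, det_succ_column_zero, Fin.sum_univ_succ]
  have hs : ∀ i : Fin k, B i.succ 0 = 0 := fun i => by simp [B, h0]
  simp only [hs, mul_zero, zero_mul, Finset.sum_const_zero, add_zero, Fin.val_zero, pow_zero,
    one_mul]
  congr 2
  ext i j
  simp [B, schurCompl_apply]
  ring

/-- Completing the square in the first variable. -/
lemma sum_quadratic_eq {k : ℕ} {A : Matrix (Fin (k + 1)) (Fin (k + 1)) ℝ}
    (hA : ∀ i j, A i j = A j i) (h0 : A 0 0 ≠ 0) (x : Fin (k + 1) → ℝ) :
    ∑ i, ∑ j, x i * A i j * x j =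
      A 0 0 * (x 0 + (∑ j : Fin k, A 0 j.succ * x j.succ) / A 0 0) ^ 2 +
        ∑ i : Fin k, ∑ j : Fin k, x i.succ * schurCompl A i j * x j.succ := by
  set L := ∑ j : Fin k, A 0 j.succ * x j.succ with hL
  have h1 : ∑ j : Fin k, x 0 * A 0 j.succ * x j.succ = x 0 * L := by
    rw [hL, Finset.mul_sum]; exact Finset.sum_congr rfl fun j _ => by ring
  have h2 : ∑ i : Fin k, x i.succ * A i.succ 0 * x 0 = x 0 * L := by
    rw [hL, Finset.mul_sum]; exact Finset.sum_congr rfl fun j _ => by rw [hA j.succ 0]; ring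
  have h3 : ∑ i : Fin k, ∑ j : Fin k, x i.succ * schurCompl A i j * x j.succ =
      (∑ i : Fin k, ∑ j : Fin k, x i.succ * A i.succ j.succ * x j.succ) - L * L / A 0 0 := by
    rw [hL, Finset.sum_mul_sum, Finset.sum_div, ← Finset.sum_sub_distrib]
    refine Finset.sum_congr rfl fun i _ => ?_
    rw [Finset.sum_div, ← Finset.sum_sub_distrib]
    refine Finset.sum_congr rfl fun j _ => ?_
    rw [schurCompl_apply, hA i.succ 0]; ring
  rw [h3]
  simp only [Fin.sum_univ_succ, Finset.sum_add_distrib, h1, h2]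
  field_simp
  ring

lemma Matrix.PosDef.schurCompl {k : ℕ} {A : Matrix (Fin (k + 1)) (Fin (k + 1)) ℝ}
    (hA : A.PosDef) : (schurCompl A).PosDef := by
  have h0 : 0 < A 0 0 := hA.diag_pos
  rw [posDef_iff_sum (schurCompl_comm hA.apply_comm)]
  intro x hx
  let y : Fin (k + 1) → ℝ := Fin.cons (-(∑ j : Fin k, A 0 j.succ * x j) / A 0 0) x
  have hy : y ≠ 0 := fun h => hx (by ext i; simpa [y] using congrFun h i.succ)
  have h := (posDef_iff_sum hA.apply_comm).1 hA y hy
  rw [sum_quadratic_eq hA.apply_comm h0.ne'] at h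
  simpa [y, neg_div] using h

lemma strictMono_cons_zero_succ {m k : ℕ} {f : Fin m → Fin k} (hf : StrictMono f) :
    StrictMono (Fin.cons 0 (Fin.succ ∘ f) : Fin (m + 1) → Fin (k + 1)) := by
  exact Fin.strictMono_cons.2 ⟨fun i => Fin.succ_pos _, Fin.strictMono_succ.comp hf⟩

/-- A symmetric real matrix with nonnegative principal minors is positive semidefinite. -/
theorem posSemidef_of_principal_minors (k : ℕ) : ∀ A : Matrix (Fin k) (Fin k) ℝ,
    (∀ i j, A i j = A j i) →
    (∀ (m : ℕ) (f : Fin m → Fin k), StrictMono f → 0 ≤ (A.submatrix f f).det) →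
    A.PosSemidef := by
  induction k with
  | zero => intro A hA _; rw [posSemidef_iff_sum hA]; simp
  | succ k ih =>
    intro A hA h
    have h00 : 0 ≤ A 0 0 := by
      simpa using h 1 (fun _ => 0) (Subsingleton.strictMono _)
    have hrow : A 0 0 = 0 → ∀ j : Fin k, A 0 j.succ = 0 := fun h0 j => by
      have h2 := h 2 ![0, j.succ] (by
        rw [Fin.strictMono_iff_lt_succ]; intro i; fin_cases i; simp)
      rw [det_fin_two] at h2
      simp only [submatrix_apply, cons_val_zero, cons_val_one, h0, zero_mul, zero_sub,
        hA j.succ 0] at h2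
      nlinarith [mul_self_nonneg (A 0 j.succ)]
    have hS : (schurCompl A).PosSemidef := by
      refine ih _ (schurCompl_comm hA) fun m f hf => ?_
      rcases h00.eq_or_lt with h0 | h0
      · have := h m (Fin.succ ∘ f) (Fin.strictMono_succ.comp hf)
        convert this using 2
        ext i j
        simp [schurCompl_apply, ← h0]
      · have := h (m + 1) (Fin.cons 0 (Fin.succ ∘ f)) (strictMono_cons_zero_succ hf)
        rw [det_eq_mul_det_schurCompl _ (by simpa using h0.ne')] at this
        exact nonneg_of_mul_nonneg_right this (by simpa using h0)
    rw [posSemidef_iff_sum hA]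
    rw [posSemidef_iff_sum (schurCompl_comm hA)] at hS
    intro x
    rcases h00.eq_or_lt with h0 | h0
    · have := hS fun i => x i.succ
      simpa [Fin.sum_univ_succ, ← h0, hrow h0.symm, hA _ 0, schurCompl_apply] using this
    · rw [sum_quadratic_eq hA h0.ne']
      exact add_nonneg (by positivity) (hS fun i => x i.succ)

theorem posDef_of_principal_minors {k : ℕ} {A : Matrix (Fin k) (Fin k) ℝ}
    (hA : ∀ i j, A i j = A j i)
    (h : ∀ (m : ℕ) (f : Fin m → Fin k), StrictMono f → 0 < (A.submatrix f f).det) :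
    A.PosDef := by
  have := posSemidef_of_principal_minors k A hA fun m f hf => (h m f hf).le
  rw [this.posDef_iff_det_ne_zero]
  exact (h k id strictMono_id).ne'

/-! ### Entrywise powers of positive definite matrices -/

/-- The FitzGerald–Horn theorem for positive definite matrices. With `B` the rank one matrix having
the same first row and column as `A`, the entrywise powers are compared along the segment from `B`
to `A`: the derivative of the quadratic form involves the entrywise product of the Schur complement
with the `(t - 1)`-st entrywise power of a positive definite matrix of smaller size. -/
theorem posDef_map_rpow (k : ℕ) : ∀ (A : Matrix (Fin k) (Fin k) ℝ) (t : ℝ), A.PosDef →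
    (∀ i j, 0 < A i j) → (k : ℝ) - 2 ≤ t → (k ≤ 1 ∨ 0 < t) →
    (A.map fun x => x ^ t).PosDef := by
  induction k with
  | zero =>
    intro A t _ _ _ _
    rw [posDef_iff_sum fun i => i.elim0]
    exact fun x hx => absurd (Subsingleton.elim x 0) hx
  | succ k ih =>
    intro A t hA hpos hk ht
    have hsymm := hA.apply_comm
    have hsymm' : ∀ i j, (A.map fun x => x ^ t) i j = (A.map fun x => x ^ t) j i :=
      fun i j => by simp [hsymm i j]
    rcases eq_or_ne t 1 with rfl | ht1
    · simpa using hA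
    rw [posDef_iff_sum hsymm']
    intro x hx
    have h00 : 0 < A 0 0 := hpos 0 0
    by_cases hx' : ∀ i : Fin k, x i.succ = 0
    · -- Only the `(0, 0)` entry contributes.
      have hx0 : x 0 ≠ 0 := fun h => hx (by ext i; exact Fin.cases h hx' i)
      have : 0 < A 0 0 ^ t := Real.rpow_pos_of_pos h00 t
      simp only [Fin.sum_univ_succ, hx', map_apply, mul_zero, zero_mul, Finset.sum_const_zero,
        add_zero]
      rw [mul_right_comm]
      exact mul_pos (mul_self_pos.2 hx0) this
    push Not at hx'
    obtain ⟨i₀, hi₀⟩ := hx'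
    have ht0 : 0 < t := ht.resolve_left (by have := i₀.pos; omega)
    let B : Matrix (Fin (k + 1)) (Fin (k + 1)) ℝ := of fun i j => A i 0 * A 0 j / A 0 0
    have hBpos : ∀ i j, 0 < B i j := fun i j => div_pos (mul_pos (hpos _ _) (hpos _ _)) h00
    let C : ℝ → Matrix (Fin (k + 1)) (Fin (k + 1)) ℝ := fun s => of fun i j =>
      B i j + s * (A i j - B i j)
    have hC : ∀ s ∈ Set.Icc (0 : ℝ) 1, ∀ i j, 0 < C s i j := fun s hs i j => by
      have h1 := hBpos i j
      have h2 := hpos i j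
      have : C s i j = (1 - s) * B i j + s * A i j := by simp only [C, of_apply]; ring
      rw [this]
      rcases hs.1.eq_or_lt with h | h
      · subst h; simpa using h1
      · exact add_pos_of_nonneg_of_pos (mul_nonneg (by linarith [hs.2]) h1.le) (mul_pos h h2)
    let G : ℝ → ℝ := fun s => ∑ i, ∑ j, x i * C s i j ^ t * x j
    let G' : ℝ → ℝ := fun s => ∑ i, ∑ j,
      x i * ((A i j - B i j) * t * C s i j ^ (t - 1)) * x j
    have hG : ∀ s ∈ Set.Icc (0 : ℝ) 1, HasDerivAt G (G' s) s := fun s hs => by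
      refine HasDerivAt.fun_sum fun i _ => HasDerivAt.fun_sum fun j _ => ?_
      have h1 : HasDerivAt (fun s => C s i j) (A i j - B i j) s := by
        simpa [C] using ((hasDerivAt_id s).mul_const (A i j - B i j)).const_add (B i j)
      exact ((h1.rpow_const (Or.inl (hC s hs i j).ne')).const_mul (x i)).mul_const (x j)
    have hG' : ∀ s ∈ Set.Ioo (0 : ℝ) 1, 0 < G' s := fun s hs => by
      have hCs := hC s ⟨hs.1.le, hs.2.le⟩
      -- The first row and column of `A - B` vanish, and the remainder is the Schur complement.
      have hEq : G' s = t * ∑ i : Fin k, ∑ j : Fin k, x i.succ *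
          (schurCompl A i j * C s i.succ j.succ ^ (t - 1)) * x j.succ := by
        have hr : ∀ j, A 0 j - B 0 j = 0 := fun j => by
          simp only [B, of_apply]; field_simp; ring
        have hc : ∀ i, A i 0 - B i 0 = 0 := fun i => by
          simp only [B, of_apply]; field_simp; ring
        simp only [G', Fin.sum_univ_succ, hr, hc, zero_mul, mul_zero, Finset.sum_const_zero,
          zero_add, Finset.mul_sum]
        refine Finset.sum_congr rfl fun i _ => Finset.sum_congr rfl fun j _ => ?_
        rw [schurCompl_apply]; simp only [B, of_apply]; ring
      have hCsymm : ∀ i j, C s i j = C s j i := fun i j => by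
        simp only [C, B, of_apply, hsymm i j, hsymm i 0, hsymm 0 j]; ring
      have hCS : schurCompl (C s) = s • schurCompl A := by
        ext i j
        simp only [schurCompl_apply, C, B, of_apply, Matrix.smul_apply, smul_eq_mul]
        field_simp
        ring
      have hCdef : (C s).PosDef := by
        rw [posDef_iff_sum hCsymm]
        intro y hy
        rw [sum_quadratic_eq hCsymm (hCs 0 0).ne', hCS]
        have hSd := (hA.schurCompl).smul hs.1
        have hSd' := hSd.posSemidef
        rw [posSemidef_iff_sum (fun i j => by simp [schurCompl_comm hsymm i j])] at hSd'
        rw [posDef_iff_sum (fun i j => by simp [schurCompl_comm hsymm i j])] at hSd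
        by_cases hy' : (fun i : Fin k => y i.succ) = 0
        · have hy0 : y 0 ≠ 0 := fun h => hy (by ext i; exact Fin.cases h (congrFun hy') i)
          have hys : ∀ i : Fin k, y i.succ = 0 := congrFun hy'
          have := hCs 0 0
          simp only [hys, mul_zero, Finset.sum_const_zero, zero_div, add_zero]
          positivity
        · exact add_pos_of_nonneg_of_pos (mul_nonneg (hCs 0 0).le (sq_nonneg _)) (hSd _ hy')
      have hpow : (((C s).submatrix Fin.succ Fin.succ).map fun x => x ^ (t - 1)).PosDef := by
        push_cast at hk
        refine ih _ (t - 1) (hCdef.submatrix (Fin.succ_injective k)) (fun i j => hCs _ _)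
          (by linarith) ?_
        rcases Nat.lt_or_ge 1 k with h | h
        · right
          have : (2 : ℝ) ≤ k := by exact_mod_cast h
          exact sub_pos.2 (lt_of_le_of_ne (by linarith) ht1.symm)
        · exact Or.inl h
      have hH := hA.schurCompl.hadamard hpow
      rw [posDef_iff_sum hH.apply_comm] at hH
      rw [hEq]
      exact mul_pos ht0 (hH (fun i => x i.succ) fun h => hi₀ (congrFun h i₀))
    have hmono : StrictMonoOn G (Set.Icc 0 1) := by
      refine strictMonoOn_of_deriv_pos (convex_Icc 0 1)
        (fun s hs => (hG s hs).continuousAt.continuousWithinAt) fun s hs => ?_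
      rw [interior_Icc] at hs
      rw [(hG s ⟨hs.1.le, hs.2.le⟩).deriv]
      exact hG' s hs
    -- At `s = 0` the quadratic form is a square.
    have hG0 : G 0 = (∑ i, x i * A i 0 ^ t) ^ 2 / A 0 0 ^ t := by
      rw [sq, Finset.sum_mul_sum, Finset.sum_div]
      refine Finset.sum_congr rfl fun i _ => ?_
      rw [Finset.sum_div]
      refine Finset.sum_congr rfl fun j _ => ?_
      simp only [C, B, of_apply, zero_mul, add_zero]
      rw [Real.div_rpow (mul_pos (hpos _ _) (hpos _ _)).le h00.le,
        Real.mul_rpow (hpos _ _).le (hpos _ _).le, hsymm 0 j]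
      ring
    have hG1 : G 1 = ∑ i, ∑ j, x i * (A.map fun x => x ^ t) i j * x j := by
      simp [G, C]
    rw [← hG1]
    refine lt_of_le_of_lt ?_ (hmono (by simp) (by simp) zero_lt_one)
    rw [hG0]
    exact div_nonneg (sq_nonneg _) (Real.rpow_nonneg h00.le t)

/-! ### Hankel matrices and their consecutive blocks -/

/-- The `k × k` Hankel matrix of the sequence `s` starting at index `p`. For a Hankel matrix `A`
with entries `s (i + j)`, these are the blocks of `A` with consecutive rows and columns. -/
def hankelBlock (s : ℕ → ℝ) (p k : ℕ) : Matrix (Fin k) (Fin k) ℝ :=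
  of fun i j => s (p + i + j)

lemma hankelBlock_apply (s : ℕ → ℝ) (p k : ℕ) (i j : Fin k) :
    hankelBlock s p k i j = s (p + i + j) := rfl

lemma hankelBlock_comm (s : ℕ → ℝ) (p k : ℕ) (i j : Fin k) :
    hankelBlock s p k i j = hankelBlock s p k j i := by
  simp only [hankelBlock_apply, add_right_comm]

lemma hankelBlock_add (s s' : ℕ → ℝ) (p k : ℕ) :
    hankelBlock (s + s') p k = hankelBlock s p k + hankelBlock s' p k := rfl

lemma hankelBlock_smul (c : ℝ) (s : ℕ → ℝ) (p k : ℕ) :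
    hankelBlock (c • s) p k = c • hankelBlock s p k := rfl

lemma IsHankel.exists_seq {n : ℕ} {A : Matrix (Fin n) (Fin n) ℝ} (hA : IsHankel A) :
    ∃ s : ℕ → ℝ, ∀ i j : Fin n, A i j = s (i + j) := by
  classical
  refine ⟨fun m => if h : ∃ q : Fin n × Fin n, (q.1 : ℕ) + q.2 = m then
    A h.choose.1 h.choose.2 else 0, fun i j => ?_⟩
  have h : ∃ q : Fin n × Fin n, (q.1 : ℕ) + q.2 = (i : ℕ) + j := ⟨(i, j), rfl⟩
  simp only [dif_pos h]
  exact hA _ _ _ _ h.choose_spec.symm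

/-- Every principal submatrix of a block of a Hankel matrix with consecutive rows and columns is a
submatrix of the Hankel matrix itself; the offset `p` is split between rows and columns. -/
lemma exists_hankelBlock_submatrix_eq {n : ℕ} {A : Matrix (Fin n) (Fin n) ℝ} {s : ℕ → ℝ}
    (hs : ∀ i j : Fin n, A i j = s (i + j)) {p k m : ℕ} (hp : p + 2 * k ≤ 2 * n)
    {f : Fin m → Fin k} (hf : StrictMono f) :
    ∃ f' g' : Fin m → Fin n, StrictMono f' ∧ StrictMono g' ∧
      (hankelBlock s p k).submatrix f f = A.submatrix f' g' := by
  refine ⟨fun i => ⟨p / 2 + f i, by have := (f i).isLt; omega⟩,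
    fun i => ⟨(p - p / 2) + f i, by have := (f i).isLt; omega⟩, ?_, ?_, ?_⟩
  · intro i j hij
    have : (f i : ℕ) < f j := hf hij
    exact Fin.mk_lt_mk.2 (by omega)
  · intro i j hij
    have : (f i : ℕ) < f j := hf hij
    exact Fin.mk_lt_mk.2 (by omega)
  · ext i j
    simp only [submatrix_apply, hankelBlock_apply, hs]
    congr 1
    omega

lemma card_le_of_strictMono {m k : ℕ} {f : Fin m → Fin k} (hf : StrictMono f) : m ≤ k := by
  simpa using Fintype.card_le_of_injective f hf.injective

lemma IsTNOrder.posSemidef_hankelBlock {r n : ℕ} {A : Matrix (Fin n) (Fin n) ℝ}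
    (hA : IsTNOrder r A) {s : ℕ → ℝ} (hs : ∀ i j : Fin n, A i j = s (i + j)) {p k : ℕ}
    (hk : k ≤ r) (hp : p + 2 * k ≤ 2 * n) : (hankelBlock s p k).PosSemidef := by
  refine posSemidef_of_principal_minors k _ (hankelBlock_comm s p k) fun m f hf => ?_
  obtain ⟨f', g', hf', hg', h⟩ := exists_hankelBlock_submatrix_eq hs hp hf
  rw [h]
  exact hA m ((card_le_of_strictMono hf).trans hk) f' g' hf' hg'

lemma IsTPOrder.posDef_hankelBlock {r n : ℕ} {A : Matrix (Fin n) (Fin n) ℝ}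
    (hA : IsTPOrder r A) {s : ℕ → ℝ} (hs : ∀ i j : Fin n, A i j = s (i + j)) {p k : ℕ}
    (hk : k ≤ r) (hp : p + 2 * k ≤ 2 * n) : (hankelBlock s p k).PosDef := by
  refine posDef_of_principal_minors (hankelBlock_comm s p k) fun m f hf => ?_
  obtain ⟨f', g', hf', hg', h⟩ := exists_hankelBlock_submatrix_eq hs hp hf
  rw [h]
  exact hA m ((card_le_of_strictMono hf).trans hk) f' g' hf' hg'

/-- By Fekete's criterion, a Hankel matrix is totally positive of order `r` as soon as its blocks of
size at most `r` with consecutive rows and columns are positive definite. -/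
theorem isTPOrder_of_posDef_hankelBlock {r n : ℕ} {A : Matrix (Fin n) (Fin n) ℝ} {s : ℕ → ℝ}
    (hs : ∀ i j : Fin n, A i j = s (i + j))
    (h : ∀ p k : ℕ, k ≤ r → p + 2 * k ≤ 2 * n → (hankelBlock s p k).PosDef) :
    IsTPOrder r A := by
  intro k hk f g hf hg
  have := det_pos_of_consecutive (r := r) (n := n) (fun i j => s (i + j)) (fun m p q hm hp hq => by
      have := (h (p + q) m hm (by omega)).det_pos
      have he : (of fun i j : Fin m => s (p + i + (q + j))) = hankelBlock s (p + q) m := by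
        ext i j
        rw [of_apply, hankelBlock_apply]
        congr 1
        omega
      rwa [he]) hk (fun i => f i) (fun i => g i) (fun _ _ hij => hf hij) (fun _ _ hij => hg hij)
      (fun i => (f i).isLt) (fun i => (g i).isLt)
  convert this using 2
  ext i j
  simp [hs]

/-! ### Approximation by totally positive Hankel matrices -/

/-- The Hankel matrices of the moments of the counting measure on `{1, …, n}` are positive definite
up to size `n`. -/
lemma posDef_hankelBlock_sum_pow {n p k : ℕ} (hk : k ≤ n) :
    (hankelBlock (fun m => ∑ c : Fin n, ((c : ℝ) + 1) ^ m) p k).PosDef := by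
  rw [posDef_iff_sum (hankelBlock_comm _ p k)]
  intro x hx
  have hform : ∑ i, ∑ j, x i * hankelBlock (fun m => ∑ c : Fin n, ((c : ℝ) + 1) ^ m) p k i j * x j
      = ∑ c : Fin n, ((c : ℝ) + 1) ^ p * (∑ i, x i * ((c : ℝ) + 1) ^ (i : ℕ)) ^ 2 := by
    have hsq : ∀ c : Fin n, ((c : ℝ) + 1) ^ p * (∑ i, x i * ((c : ℝ) + 1) ^ (i : ℕ)) ^ 2 =
        ∑ i : Fin k, ∑ j : Fin k, x i * ((c : ℝ) + 1) ^ (p + i + j) * x j := fun c => by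
      rw [sq, Finset.sum_mul_sum, Finset.mul_sum]
      refine Finset.sum_congr rfl fun i _ => ?_
      rw [Finset.mul_sum]
      exact Finset.sum_congr rfl fun j _ => by ring
    simp_rw [hsq, hankelBlock_apply, Finset.mul_sum, Finset.sum_mul]
    rw [Finset.sum_comm (s := Finset.univ (α := Fin n))]
    exact Finset.sum_congr rfl fun i _ => Finset.sum_comm
  rw [hform]
  refine lt_of_le_of_ne (Finset.sum_nonneg fun c _ => by positivity) fun h0 => hx ?_
  have hz := (Finset.sum_eq_zero_iff_of_nonneg fun c _ => by positivity).1 h0.symm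
  -- The vector `x` lies in the kernel of an invertible Vandermonde matrix.
  refine eq_zero_of_mulVec_eq_zero (M := vandermonde fun c : Fin k => ((c : ℕ) : ℝ) + 1) ?_ ?_
  · rw [det_vandermonde_ne_zero_iff]
    intro a b hab
    exact Fin.ext (by simpa using hab)
  · ext c
    have := hz (Fin.castLE hk c) (Finset.mem_univ _)
    have h1 : (((Fin.castLE hk c : Fin n) : ℕ) : ℝ) + 1 ≠ 0 := by positivity
    have h2 := (mul_eq_zero.1 this).resolve_left (pow_ne_zero p h1)
    simpa [mulVec, dotProduct, vandermonde_apply, mul_comm] using h2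

/-- Adding a positive multiple of a moment matrix turns a Hankel matrix which is totally nonnegative
of order `r` into one which is totally positive of order `r`. -/
lemma IsTNOrder.isTPOrder_add_moments {r n : ℕ} {A : Matrix (Fin n) (Fin n) ℝ}
    (hA : IsTNOrder r A) (hH : IsHankel A) {ε : ℝ} (hε : 0 < ε) :
    IsTPOrder r (of fun i j => A i j + ε * ∑ c : Fin n, ((c : ℝ) + 1) ^ ((i : ℕ) + j)) := by
  obtain ⟨s, hs⟩ := hH.exists_seq
  refine isTPOrder_of_posDef_hankelBlock
    (s := s + ε • fun m => ∑ c : Fin n, ((c : ℝ) + 1) ^ m) (fun i j => by simp [hs]) ?_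
  intro p k hk hp
  rw [hankelBlock_add, hankelBlock_smul]
  exact Matrix.PosDef.posSemidef_add (hA.posSemidef_hankelBlock hs hk hp)
    ((posDef_hankelBlock_sum_pow (by omega)).smul hε)

/-! ### Entrywise powers of Hankel matrices -/

lemma IsHankel.hadamardRPow {n : ℕ} {A : Matrix (Fin n) (Fin n) ℝ} (hA : IsHankel A) (t : ℝ) :
    IsHankel (hadamardRPow A t) :=
  fun i i' j j' h => congrArg (· ^ t) (hA i i' j j' h)

lemma IsTPOrder.apply_pos {r n : ℕ} {A : Matrix (Fin n) (Fin n) ℝ} (hA : IsTPOrder r A)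
    (hr : 1 ≤ r) (i j : Fin n) : 0 < A i j := by
  simpa using hA 1 hr (fun _ => i) (fun _ => j) (Subsingleton.strictMono _)
    (Subsingleton.strictMono _)

theorem IsTPOrder.hadamardRPow {r n : ℕ} (hr : 3 ≤ r) {A : Matrix (Fin n) (Fin n) ℝ}
    (hH : IsHankel A) {t : ℝ} (ht : (r : ℝ) - 2 ≤ t) (hA : IsTPOrder r A) :
    IsTPOrder r (hadamardRPow A t) := by
  obtain ⟨s, hs⟩ := hH.exists_seq
  have hr' : (3 : ℝ) ≤ r := by exact_mod_cast hr
  refine isTPOrder_of_posDef_hankelBlock (s := fun m => s m ^ t)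
    (fun i j => by simp [_root_.hadamardRPow, hs]) fun p k hk hp => ?_
  have hk' : (k : ℝ) ≤ r := by exact_mod_cast hk
  refine posDef_map_rpow k (hankelBlock s p k) t (hA.posDef_hankelBlock hs hk hp) (fun i j => ?_)
    (by linarith) (Or.inr (by linarith))
  have := hA.apply_pos (by omega) ⟨p / 2 + i, by omega⟩ ⟨p - p / 2 + j, by omega⟩
  rw [hs] at this
  rw [hankelBlock_apply]
  convert this using 2
  simp only
  omega

theorem IsTNOrder.hadamardRPow {r n : ℕ} (hr : 3 ≤ r) {A : Matrix (Fin n) (Fin n) ℝ}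
    (hH : IsHankel A) {t : ℝ} (ht : (r : ℝ) - 2 ≤ t) (hA : IsTNOrder r A) :
    IsTNOrder r (hadamardRPow A t) := by
  intro k hk f g hf hg
  have hr' : (3 : ℝ) ≤ r := by exact_mod_cast hr
  have ht0 : 0 ≤ t := by linarith
  let M : ℝ → Matrix (Fin n) (Fin n) ℝ := fun ε =>
    of fun i j => A i j + ε * ∑ c : Fin n, ((c : ℝ) + 1) ^ ((i : ℕ) + j)
  have hM : ∀ ε, IsHankel (M ε) := fun ε i i' j j' h => by
    simp only [M, of_apply, hH i i' j j' h, h]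
  have hcont : Continuous fun ε => ((_root_.hadamardRPow (M ε) t).submatrix f g).det := by
    refine Continuous.matrix_det (continuous_matrix fun i j => ?_)
    simp only [_root_.hadamardRPow, submatrix_apply, map_apply, M, of_apply]
    exact Continuous.rpow_const (by fun_prop) fun _ => Or.inr ht0
  have h0 : M 0 = A := by ext i j; simp [M]
  have hlim := (hcont.tendsto 0).mono_left (nhdsWithin_le_nhds (s := Set.Ioi 0))
  rw [h0] at hlim
  refine ge_of_tendsto hlim ?_
  filter_upwards [self_mem_nhdsWithin] with ε hε
  exact ((hA.isTPOrder_add_moments hH hε).hadamardRPow hr (hM ε) ht k hk f g hf hg).le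

theorem theorem5p11 (r : ℕ) (hr : 3 ≤ r) (n : ℕ) (A : Matrix (Fin n) (Fin n) ℝ)
    (hA : IsHankel A) (t : ℝ) (ht : (r : ℝ) - 2 ≤ t) :
    (IsTNOrder r A → IsHankel (hadamardRPow A t) ∧ IsTNOrder r (hadamardRPow A t)) ∧
      (IsTPOrder r A → IsHankel (hadamardRPow A t) ∧ IsTPOrder r (hadamardRPow A t)) :=
  ⟨fun h => ⟨hA.hadamardRPow t, h.hadamardRPow hr hA ht⟩,
    fun h => ⟨hA.hadamardRPow t, h.hadamardRPow hr hA ht⟩⟩
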